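/- Let $f:\mathbb{R}^m\to\mathbb{R}\cup\{+\infty\}$ be proper and lower semicontinuous, and let $g:\mathbb{R}^m\to\mathbb{R}$ be differentiable with $L_g$-Lipschitz continuous gradient, $L_g\ge 0$. Let $(\alpha_n)_{n\in\mathbb N},(\beta_n)_{n\in\mathbb N}$ be real sequences with $\alpha_n\to\alpha$, $\beta_n\to\beta\in\mathbb{R}$, let $s>0$, let $x_{-1}=x_0\in\mathbb{R}^m$, and let $(x_n)_{n\in\mathbb N},(y_n)_{n\in\mathbb N},(z_n)_{n\in\mathbb N}$ satisfy, for all $n\in\mathbb{N}=\{0,1,2,\dots\}$, $$y_n=x_n+\alpha_n(x_n-x_{n-1}),\qquad z_n=x_n+\beta_n(x_n-x_{n-1}),$$ and one of the following (where the upper bound on $s$ is read as $+\infty$ if $L_g=0$): * (PADISNO) $f$ is bounded from below, $\alpha\in(-\tfrac12,\tfrac12)$, $0<s<\frac{1-2|\alpha|}{L_g(2|\beta|+1)}$, and for all $n\in\mathbb N$ $$x_{n+1}\in\operatorname*{argmin}_{y\in\mathbb{R}^m}\Big\{f(y)+\langle\nabla g(z_n),y-y_n\rangle+\frac1{2s}\|y-y_n\|^2\Big\};$$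 * (c-PADISNO) $f$ is convex, $\alpha\in(-1,1)$, $0<s<\frac{2(1-|\alpha|)}{L_g(2|\beta|+1)}$, and for all $n\in\mathbb N$ $$x_{n+1}=\operatorname{prox}_{sf}(y_n-s\nabla g(z_n))=\operatorname*{argmin}_{y\in\mathbb{R}^m}\Big\{f(y)+\frac1{2s}\|y-(y_n-s\nabla g(z_n))\|^2\Big\}.$$ Assume that $f+g$ is strongly convex. Then $f+g$ has a unique minimizer $x^*$, and there exist $Q\in[0,1)$, $a_1>0$ and $\overline N\in\mathbb{N}$ such that for every $n\ge\overline N$: (i) $(f+g)(x_n)-(f+g)(x^*)\le a_1Q^n$; (ii) $\|x_n-x^*\|\le a_1Q^{n/2}$, $\|y_n-x^*\|\le a_1Q^{n/2}$ and $\|z_n-x^*\|\le a_1Q^{n/2}$. -/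

import Mathlib

open Filter Topology
open scoped Gradient NNReal

noncomputable section

/-- The effective domain of an extended-real-valued function. -/
def effDom {m : ℕ} (f : EuclideanSpace ℝ (Fin m) → EReal) : Set (EuclideanSpace ℝ (Fin m)) :=
  {x | f x < ⊤}

/-- `f` takes values in `ℝ ∪ {+∞}` and is not identically `+∞`. -/
def IsProperFun {m : ℕ} (f : EuclideanSpace ℝ (Fin m) → EReal) : Prop :=
  (∀ x, f x ≠ ⊥) ∧ (effDom f).Nonempty

/-- Convexity of a function with values in `ℝ ∪ {+∞}`: the domain is convex and the (real-valued)
restriction to the domain is convex. -/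
def IsConvexFun {m : ℕ} (f : EuclideanSpace ℝ (Fin m) → EReal) : Prop :=
  ConvexOn ℝ (effDom f) (fun x => (f x).toReal)

/-- Strong convexity (with some modulus `μ > 0`) of a function with values in `ℝ ∪ {+∞}`. -/
def IsStronglyConvexFun {m : ℕ} (f : EuclideanSpace ℝ (Fin m) → EReal) : Prop :=
  ∃ μ : ℝ, 0 < μ ∧ StrongConvexOn (effDom f) μ (fun x => (f x).toReal)

/-- The set of global minimizers. -/
def argminSet {m : ℕ} (F : EuclideanSpace ℝ (Fin m) → EReal) : Set (EuclideanSpace ℝ (Fin m)) :=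
  {p | ∀ q, F p ≤ F q}

/-- The objective function `f + g`. -/
def objective {m : ℕ} (f : EuclideanSpace ℝ (Fin m) → EReal) (g : EuclideanSpace ℝ (Fin m) → ℝ) :
    EuclideanSpace ℝ (Fin m) → EReal :=
  fun x => f x + (g x : EReal)

/-- `p = prox_{s f}(v)`, i.e. `p` minimizes `q ↦ f q + ‖q - v‖² / (2 s)`; for proper, convex, lower
semicontinuous `f` and `s > 0` there is exactly one such `p`. -/
def IsProx {m : ℕ} (s : ℝ) (f : EuclideanSpace ℝ (Fin m) → EReal)
    (v p : EuclideanSpace ℝ (Fin m)) : Prop :=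
  p ∈ argminSet (fun q => f q + ((1 / (2 * s) * ‖q - v‖ ^ 2 : ℝ) : EReal))

/-- The standing assumptions: `f` is proper and lower semicontinuous, `g` is differentiable with
`L`-Lipschitz gradient. -/
structure ProblemSetting {m : ℕ} (f : EuclideanSpace ℝ (Fin m) → EReal)
    (g : EuclideanSpace ℝ (Fin m) → ℝ) (L : ℝ≥0) : Prop where
  proper : IsProperFun f
  lsc : LowerSemicontinuous f
  diff : Differentiable ℝ g
  lipschitz : LipschitzWith L (∇ g)

/-- The extrapolation steps. Since subtraction on `ℕ` is truncated, `x (0 - 1) = x 0`, which is the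
convention `x_{-1} = x_0`. -/
structure Extrapolation {m : ℕ} (α β : ℕ → ℝ) (x y z : ℕ → EuclideanSpace ℝ (Fin m)) : Prop where
  y_eq : ∀ n, y n = x n + α n • (x n - x (n - 1))
  z_eq : ∀ n, z n = x n + β n • (x n - x (n - 1))

/-- `x, y, z` are generated by PADISNO with inertial parameters `α n → a`, `β n → b` and step
size `s`. The bound `s < (1 - 2|a|) / (L (2|b| + 1))` is written without division, so that for
`L = 0` it puts no upper bound on `s`. -/
structure IsPADISNO {m : ℕ} (f : EuclideanSpace ℝ (Fin m) → EReal)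
    (g : EuclideanSpace ℝ (Fin m) → ℝ) (L : ℝ≥0) (α β : ℕ → ℝ) (a b s : ℝ)
    (x y z : ℕ → EuclideanSpace ℝ (Fin m)) : Prop where
  bddBelow : ∃ c : ℝ, ∀ q, (c : EReal) ≤ f q
  α_lim : Tendsto α atTop (𝓝 a)
  a_mem : a ∈ Set.Ioo (-(1 / 2) : ℝ) (1 / 2)
  β_lim : Tendsto β atTop (𝓝 b)
  s_pos : 0 < s
  s_lt : s * ((L : ℝ) * (2 * |b| + 1)) < 1 - 2 * |a|
  extrapolation : Extrapolation α β x y z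
  step : ∀ n, x (n + 1) ∈ argminSet (fun q =>
    f q + ((inner ℝ (∇ g (z n)) (q - y n) + 1 / (2 * s) * ‖q - y n‖ ^ 2 : ℝ) : EReal))

/-- `x, y, z` are generated by c-PADISNO (`f` convex) with inertial parameters `α n → a`,
`β n → b` and step size `s`. The bound `s < 2 (1 - |a|) / (L (2|b| + 1))` is written without
division, so that for `L = 0` it puts no upper bound on `s`. -/
structure IsCPADISNO {m : ℕ} (f : EuclideanSpace ℝ (Fin m) → EReal)
    (g : EuclideanSpace ℝ (Fin m) → ℝ) (L : ℝ≥0) (α β : ℕ → ℝ) (a b s : ℝ)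
    (x y z : ℕ → EuclideanSpace ℝ (Fin m)) : Prop where
  convex : IsConvexFun f
  α_lim : Tendsto α atTop (𝓝 a)
  a_mem : a ∈ Set.Ioo (-1 : ℝ) 1
  β_lim : Tendsto β atTop (𝓝 b)
  s_pos : 0 < s
  s_lt : s * ((L : ℝ) * (2 * |b| + 1)) < 2 * (1 - |a|)
  extrapolation : Extrapolation α β x y z
  step : ∀ n, IsProx s f (y n - s • ∇ g (z n)) (x (n + 1))

end

/-! Let `r n` be the gap of `f + g` at `x n` and `δ n = ‖x n - x (n - 1)‖`. Comparing `x (n + 1)`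
with `x n` in the subproblem, and using the descent lemma for `g`, one gets
`r (n + 1) ≤ r n - A * δ (n + 1) ^ 2 + c * (δ n * δ (n + 1))` with `A = κ / (2 * s) - L / 2` and
`c = a / s + L * b`, where `a`, `b` bound `|α n|`, `|β n|`, and `κ = 2` if `f` is convex and
`κ = 1` otherwise; the bound on the step size says exactly that `c < A`. Since `f + g` is strongly
convex, the first-order optimality of `x (n + 1)` in its subproblem gives
`r (n + 1) ≤ K * (δ n + δ (n + 1)) ^ 2`. Hence, for the Lyapunov function
`V n = r n + A / 2 * δ n ^ 2`, a multiple of `δ n ^ 2 + δ (n + 1) ^ 2` bounds `V n - V (n + 1)`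
from below and another one bounds `V (n + 1)` from above, so that `V (n + 1) ≤ Q * V n` with
`Q < 1`. The quadratic growth of `f + g` at its minimizer turns this into the bounds on the
distances.
-/

open Set
open scoped RealInnerProductSpace

section StrongConvexity

variable {E : Type*} [NormedAddCommGroup E] [NormedSpace ℝ E] {D : Set E} {μ : ℝ} {H : E → ℝ}

theorem add_sq_norm_le_of_isMinOn_add (hH : StrongConvexOn D μ H) {k : E → ℝ} {k' : E →L[ℝ] ℝ}
    {p u : E} (hk : HasFDerivAt k k' p) (hp : p ∈ D) (hmin : IsMinOn (fun q => H q + k q) D p)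
    (hu : u ∈ D) : H p + μ / 2 * ‖u - p‖ ^ 2 ≤ H u + k' (u - p) := by
  have hsegment : ∀ t ∈ Ioo (0 : ℝ) 1,
      H p + (1 - t) * (μ / 2 * ‖u - p‖ ^ 2) ≤ H u + t⁻¹ • (k (p + t • (u - p)) - k p) := by
    rintro t ⟨ht₀, ht₁⟩
    have hcomb : (1 - t) • p + t • u = p + t • (u - p) := by module
    have hmem := hH.1 hp hu (sub_nonneg.2 ht₁.le) ht₀.le (by ring)
    have hconv := hH.2 hp hu (sub_nonneg.2 ht₁.le) ht₀.le (by ring)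
    rw [hcomb] at hmem hconv
    have hle := isMinOn_iff.1 hmin _ hmem
    rw [norm_sub_rev] at hconv
    simp only [smul_eq_mul] at hconv ⊢
    rw [inv_mul_eq_div, ← sub_le_iff_le_add', le_div_iff₀ ht₀]
    linarith
  have hslope : Tendsto (fun t : ℝ => t⁻¹ • (k (p + t • (u - p)) - k p)) (𝓝[>] 0)
      (𝓝 (k' (u - p))) :=
    (hk.hasLineDerivAt (u - p)).tendsto_slope_zero_right
  have hleft : Tendsto (fun t : ℝ => H p + (1 - t) * (μ / 2 * ‖u - p‖ ^ 2)) (𝓝[>] 0)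
      (𝓝 (H p + (1 - 0) * (μ / 2 * ‖u - p‖ ^ 2))) :=
    (Continuous.tendsto (by fun_prop) 0).mono_left nhdsWithin_le_nhds
  simpa using le_of_tendsto_of_tendsto hleft (hslope.const_add (H u))
    (mem_of_superset (Ioo_mem_nhdsGT one_pos) hsegment)

theorem sq_norm_sub_le_of_isMinOn (hH : StrongConvexOn D μ H) {p u : E} (hp : p ∈ D)
    (hmin : IsMinOn H D p) (hu : u ∈ D) : μ / 2 * ‖u - p‖ ^ 2 ≤ H u - H p := by
  have h := add_sq_norm_le_of_isMinOn_add hH (hasFDerivAt_const (0 : ℝ) p) hp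
    (by simpa only [add_zero] using hmin) hu
  simp only [zero_apply, add_zero] at h
  linarith

theorem sq_norm_sub_le_of_le_add (hH : StrongConvexOn D μ H) {c δ : ℝ} (hc : ∀ q ∈ D, c ≤ H q)
    {u v : E} (hu : u ∈ D) (hv : v ∈ D) (huδ : H u ≤ c + δ) (hvδ : H v ≤ c + δ) :
    μ / 8 * ‖u - v‖ ^ 2 ≤ δ := by
  have hhalf : (0 : ℝ) ≤ 1 / 2 := by norm_num
  have hmid := hc _ (hH.1 hu hv hhalf hhalf (by norm_num))
  have hconv := hH.2 hu hv hhalf hhalf (by norm_num)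
  simp only [smul_eq_mul] at hconv
  linarith

theorem sub_sub_le_of_strongConvexOn (hμ : 0 < μ) (hH : StrongConvexOn D μ H) {x₀ q : E}
    {ε δ : ℝ} (hx₀ : x₀ ∈ D) (hε : 0 < ε) (hball : ∀ q ∈ D, ‖q - x₀‖ < ε → H x₀ - δ < H q)
    (hq : q ∈ D) : H x₀ - δ - 4 * δ ^ 2 / (μ * ε ^ 2) ≤ H q := by
  rcases lt_or_ge ‖q - x₀‖ ε with hnear | hfar
  · have hpos : 0 ≤ 4 * δ ^ 2 / (μ * ε ^ 2) := by positivity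
    linarith [hball q hq hnear]
  have hδ : H x₀ - δ < H x₀ := hball x₀ hx₀ (by simpa only [sub_self, norm_zero] using hε)
  set R := ‖q - x₀‖ with hR
  have hR₀ : 0 < R := hε.trans_le hfar
  -- the point of the segment `[x₀, q]` at distance `ε / 2` from `x₀`
  set t := ε / (2 * R) with ht
  have ht₀ : 0 < t := by positivity
  have ht_half : t ≤ 1 / 2 := by
    rw [ht, div_le_div_iff₀ (by positivity) two_pos]
    linarith
  have hmem := hH.1 hx₀ hq (by linarith : 0 ≤ 1 - t) ht₀.le (by ring)
  have hconv := hH.2 hx₀ hq (by linarith : 0 ≤ 1 - t) ht₀.le (by ring)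
  have hlow := hball _ hmem (by
    have hdiff : (1 - t) • x₀ + t • q - x₀ = t • (q - x₀) := by module
    rw [hdiff, norm_smul, Real.norm_of_nonneg ht₀.le, ← hR, ht]
    field_simp
    linarith)
  rw [norm_sub_rev, ← hR] at hconv
  simp only [smul_eq_mul] at hconv
  have hquad : t * (H x₀ - H q) ≤ δ - t * (μ / 4 * R ^ 2) := by
    nlinarith [mul_nonneg (mul_nonneg ht₀.le (sub_nonneg.2 ht_half))
      (mul_nonneg hμ.le (sq_nonneg R))]
  have hlin : H x₀ - H q ≤ 2 * R / ε * δ - μ / 4 * R ^ 2 := by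
    have hinv : 2 * R / ε = t⁻¹ := by rw [ht, inv_div]
    calc H x₀ - H q = t⁻¹ * (t * (H x₀ - H q)) := by field_simp
      _ ≤ t⁻¹ * (δ - t * (μ / 4 * R ^ 2)) := by gcongr
      _ = 2 * R / ε * δ - μ / 4 * R ^ 2 := by rw [hinv]; field_simp
  have hsquare : 4 * δ ^ 2 / (μ * ε ^ 2) - (2 * R / ε * δ - μ / 4 * R ^ 2) =
      (2 * δ / ε - μ * R / 2) ^ 2 / μ := by
    field_simp
    ring
  have hsquare_nonneg : 0 ≤ (2 * δ / ε - μ * R / 2) ^ 2 / μ := by positivity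
  linarith

theorem bddBelow_image_of_strongConvexOn (hμ : 0 < μ) (hH : StrongConvexOn D μ H)
    (hclosed : ∀ r, IsClosed {q ∈ D | H q ≤ r}) : BddBelow (H '' D) := by
  rcases D.eq_empty_or_nonempty with rfl | ⟨x₀, hx₀⟩
  · simp
  obtain ⟨ε, hε, hsub⟩ := Metric.isOpen_iff.1 (hclosed (H x₀ - 1)).isOpen_compl x₀
    (fun h => by linarith [h.2])
  have hball : ∀ q ∈ D, ‖q - x₀‖ < ε → H x₀ - 1 < H q := fun q hq hqε =>
    lt_of_not_ge fun hle => hsub (by rwa [Metric.mem_ball, dist_eq_norm]) ⟨hq, hle⟩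
  exact ⟨_, forall_mem_image.2 fun q hq => sub_sub_le_of_strongConvexOn hμ hH hx₀ hε hball hq⟩

theorem exists_isMinOn_of_strongConvexOn [CompleteSpace E] (hμ : 0 < μ)
    (hH : StrongConvexOn D μ H) (hD : D.Nonempty) (hclosed : ∀ r, IsClosed {q ∈ D | H q ≤ r}) :
    ∃ p ∈ D, IsMinOn H D p := by
  have hbdd := bddBelow_image_of_strongConvexOn hμ hH hclosed
  set c := sInf (H '' D)
  have hc : ∀ q ∈ D, c ≤ H q := fun q hq => csInf_le hbdd (mem_image_of_mem H hq)
  set S : ℕ → Set E := fun n => {q ∈ D | H q ≤ c + 1 / ((n : ℝ) + 1)}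
  have hdist : ∀ n, ∀ u ∈ S n, ∀ v ∈ S n, dist u v ≤ √(8 / μ * (1 / ((n : ℝ) + 1))) := by
    intro n u hu v hv
    have h := sq_norm_sub_le_of_le_add hH hc hu.1 hv.1 hu.2 hv.2
    rw [dist_eq_norm]
    refine Real.le_sqrt_of_sq_le ?_
    calc ‖u - v‖ ^ 2 = 8 / μ * (μ / 8 * ‖u - v‖ ^ 2) := by field_simp
      _ ≤ 8 / μ * (1 / ((n : ℝ) + 1)) := by gcongr
  have hinter : ∀ N, (⋂ n ≤ N, S n).Nonempty := by
    intro N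
    obtain ⟨_, ⟨q, hq, rfl⟩, hlt⟩ := exists_lt_of_csInf_lt (hD.image H)
      (lt_add_of_pos_right c (Nat.one_div_pos_of_nat (n := N)))
    refine ⟨q, mem_iInter₂.2 fun n hn => ⟨hq, hlt.le.trans ?_⟩⟩
    gcongr
  have hdiam : Tendsto (fun n => Metric.diam (S n)) atTop (𝓝 0) := by
    refine squeeze_zero (fun n => Metric.diam_nonneg)
      (fun n => Metric.diam_le_of_forall_dist_le (Real.sqrt_nonneg _) (hdist n)) ?_
    simpa using (tendsto_one_div_add_atTop_nhds_zero_nat.const_mul (8 / μ)).sqrt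
  obtain ⟨p, hp⟩ := Metric.nonempty_iInter_of_nonempty_biInter (fun n => hclosed _)
    (fun n => Metric.isBounded_iff.2 ⟨_, fun u hu v hv => hdist n u hu v hv⟩) hinter hdiam
  rw [mem_iInter] at hp
  have hpc : H p ≤ c := by
    have hlim := tendsto_one_div_add_atTop_nhds_zero_nat.const_add c
    rw [add_zero] at hlim
    exact ge_of_tendsto' hlim fun n => (hp n).2
  exact ⟨p, (hp 0).1, isMinOn_iff.2 fun q hq => hpc.trans (hc q hq)⟩

end StrongConvexity

section ProximalGradientStep

variable {E : Type*} [NormedAddCommGroup E] [InnerProductSpace ℝ E]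

/-- The term `⟪c, q - y⟫ + ‖q - y‖² / (2 s)` that a proximal gradient step from `y` with step size
`s` adds to the nonsmooth function; `c` stands for the gradient of the smooth one. -/
noncomputable def proxTerm (s : ℝ) (c y q : E) : ℝ :=
  ⟪c, q - y⟫ + 1 / (2 * s) * ‖q - y‖ ^ 2

theorem proxTerm_eq_add_inner_add_sq (s : ℝ) (c y p q : E) :
    proxTerm s c y q =
      proxTerm s c y p + ⟪c + s⁻¹ • (p - y), q - p⟫ + 1 / (2 * s) * ‖q - p‖ ^ 2 := by
  have hq : q - y = (p - y) + (q - p) := by abel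
  rw [proxTerm, hq, norm_add_sq_real, inner_add_right, inner_add_left, real_inner_smul_left,
    proxTerm, one_div, mul_inv]
  ring

theorem proxTerm_add_const_eq {s : ℝ} (hs : s ≠ 0) (c y q : E) :
    proxTerm s c y q + s / 2 * ‖c‖ ^ 2 = 1 / (2 * s) * ‖q - (y - s • c)‖ ^ 2 := by
  have hq : q - (y - s • c) = (q - y) + s • c := by abel
  rw [hq, norm_add_sq_real, real_inner_smul_right, real_inner_comm, norm_smul, mul_pow,
    Real.norm_eq_abs, sq_abs, proxTerm]
  field_simp
  ring

theorem hasGradientAt_proxTerm [CompleteSpace E] (s : ℝ) (c y p : E) :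
    HasGradientAt (proxTerm s c y) (c + s⁻¹ • (p - y)) p := by
  have hsub : HasFDerivAt (fun q => q - y) (.id ℝ E) p := (hasFDerivAt_id p).sub_const y
  have hinner := (innerSL ℝ c).hasFDerivAt.comp p hsub
  have hsq := hsub.norm_sq.const_mul (1 / (2 * s))
  rw [hasGradientAt_iff_hasFDerivAt]
  refine (hinner.add hsq).congr_fderiv ?_
  ext q
  simp
  ring

theorem descent_of_proxTerm_le {φ : E → ℝ} {s : ℝ} {c p x y : E}
    (h : φ p + proxTerm s c y p ≤ φ x + proxTerm s c y x) :
    φ p + ⟪c + s⁻¹ • (x - y), p - x⟫ + 1 / (2 * s) * ‖p - x‖ ^ 2 ≤ φ x := by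
  rw [proxTerm_eq_add_inner_add_sq s c y x p] at h
  linarith

variable [CompleteSpace E] {D : Set E} {φ g : E → ℝ} {L : ℝ≥0} {s κ μ : ℝ}

theorem descent_of_convexOn_of_isMinOn {c p x y : E} (hφ : ConvexOn ℝ D φ) (hp : p ∈ D)
    (hmin : IsMinOn (fun q => φ q + proxTerm s c y q) D p) (hx : x ∈ D) :
    φ p + ⟪c + s⁻¹ • (x - y), p - x⟫ + 2 / (2 * s) * ‖p - x‖ ^ 2 ≤ φ x := by
  have h := add_sq_norm_le_of_isMinOn_add (strongConvexOn_zero.2 hφ)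
    (hasGradientAt_proxTerm s c y p).hasFDerivAt hp hmin hx
  have hsplit : ⟪c + s⁻¹ • (p - y), x - p⟫ =
      -(⟪c + s⁻¹ • (x - y), p - x⟫ + 2 / (2 * s) * ‖p - x‖ ^ 2) := by
    have hgrad : c + s⁻¹ • (p - y) = c + s⁻¹ • (x - y) + s⁻¹ • (p - x) := by module
    have hinv : 2 / (2 * s) = s⁻¹ := by rw [← div_div, div_self two_ne_zero, one_div]
    rw [← neg_sub p x, inner_neg_right, hgrad, inner_add_left _ (s⁻¹ • (p - x)),
      real_inner_smul_left, real_inner_self_eq_norm_sq, hinv]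
  rw [InnerProductSpace.toDual_apply_apply, hsplit] at h
  linarith

theorem le_add_inner_gradient_add_sq (hg : Differentiable ℝ g) (hL : LipschitzWith L (∇ g))
    (x y : E) : g y ≤ g x + ⟪∇ g x, y - x⟫ + L / 2 * ‖y - x‖ ^ 2 := by
  set v := y - x with hv
  have hline : ∀ t : ℝ, HasDerivAt (fun t : ℝ => g (x + t • v)) ⟪∇ g (x + t • v), v⟫ t := by
    intro t
    have hpath : HasDerivAt (fun t : ℝ => x + t • v) v t := by
      simpa using ((hasDerivAt_id t).smul_const v).const_add x
    have hchain := (hg (x + t • v)).hasGradientAt.hasFDerivAt.comp_hasDerivAt t hpath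
    rwa [InnerProductSpace.toDual_apply_apply] at hchain
  have hmodel : ∀ t : ℝ, HasDerivAt (fun t : ℝ => g x + t * ⟪∇ g x, v⟫ + L / 2 * ‖v‖ ^ 2 * t ^ 2)
      (⟪∇ g x, v⟫ + L * ‖v‖ ^ 2 * t) t := by
    intro t
    refine ((((hasDerivAt_id t).mul_const ⟪∇ g x, v⟫).const_add (g x)).add
      ((hasDerivAt_pow 2 t).const_mul (L / 2 * ‖v‖ ^ 2))).congr_deriv ?_
    simp only [Nat.cast_ofNat, one_mul]
    ring
  have hslope : ∀ t ∈ Ico (0 : ℝ) 1,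
      ⟪∇ g (x + t • v), v⟫ ≤ ⟪∇ g x, v⟫ + L * ‖v‖ ^ 2 * t := by
    intro t ht
    rw [← sub_le_iff_le_add', ← inner_sub_left]
    calc ⟪∇ g (x + t • v) - ∇ g x, v⟫ ≤ ‖∇ g (x + t • v) - ∇ g x‖ * ‖v‖ := real_inner_le_norm _ _
      _ ≤ L * ‖x + t • v - x‖ * ‖v‖ := by gcongr; exact hL.norm_sub_le _ _
      _ = L * ‖v‖ ^ 2 * t := by
        rw [add_sub_cancel_left, norm_smul, Real.norm_of_nonneg ht.1]
        ring
  have h := image_le_of_deriv_right_le_deriv_boundary (a := 0) (b := 1)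
    (fun t _ => (hline t).continuousAt.continuousWithinAt) (fun t _ => (hline t).hasDerivWithinAt)
    (by simp) (fun t _ => (hmodel t).continuousAt.continuousWithinAt)
    (fun t _ => (hmodel t).hasDerivWithinAt) hslope (right_mem_Icc.2 zero_le_one)
  simpa [hv] using h

theorem sum_le_sub_of_descent (hg : Differentiable ℝ g) (hL : LipschitzWith L (∇ g)) (hs : 0 < s)
    {p x y z : E}
    (h : φ p + ⟪∇ g z + s⁻¹ • (x - y), p - x⟫ + κ / (2 * s) * ‖p - x‖ ^ 2 ≤ φ x) :
    φ p + g p ≤ φ x + g x - (κ / (2 * s) - L / 2) * ‖p - x‖ ^ 2 +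
      (s⁻¹ * ‖x - y‖ + L * ‖x - z‖) * ‖p - x‖ := by
  have hdescent := le_add_inner_gradient_add_sq hg hL x p
  have herror : ⟪∇ g x, p - x⟫ - ⟪∇ g z + s⁻¹ • (x - y), p - x⟫ ≤
      (s⁻¹ * ‖x - y‖ + L * ‖x - z‖) * ‖p - x‖ := by
    rw [← inner_sub_left]
    refine (real_inner_le_norm _ _).trans ?_
    gcongr
    calc ‖∇ g x - (∇ g z + s⁻¹ • (x - y))‖ = ‖-(s⁻¹ • (x - y)) + (∇ g x - ∇ g z)‖ := by
          congr 1; abel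
      _ ≤ ‖-(s⁻¹ • (x - y))‖ + ‖∇ g x - ∇ g z‖ := norm_add_le _ _
      _ ≤ s⁻¹ * ‖x - y‖ + L * ‖x - z‖ := by
        rw [norm_neg, norm_smul, Real.norm_of_nonneg (inv_nonneg.2 hs.le)]
        gcongr
        exact hL.norm_sub_le _ _
  linarith

theorem gap_le_sq_of_isMinOn (hg : Differentiable ℝ g) (hL : LipschitzWith L (∇ g)) (hs : 0 < s)
    (hμ : 0 < μ) (hsc : StrongConvexOn D μ fun q => φ q + g q) {p u y z : E} (hp : p ∈ D)
    (hmin : IsMinOn (fun q => φ q + proxTerm s (∇ g z) y q) D p) (hu : u ∈ D) :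
    φ p + g p - (φ u + g u) ≤ (s⁻¹ * ‖p - y‖ + L * ‖p - z‖) ^ 2 / (2 * μ) := by
  set w := ∇ g z + s⁻¹ • (p - y) - ∇ g p with hw
  have hopt := add_sq_norm_le_of_isMinOn_add hsc
    ((hasGradientAt_proxTerm s (∇ g z) y p).hasFDerivAt.sub (hg p).hasGradientAt.hasFDerivAt) hp
    (by simpa using hmin) hu
  rw [sub_apply, InnerProductSpace.toDual_apply_apply,
    InnerProductSpace.toDual_apply_apply, ← inner_sub_left, ← hw] at hopt
  have hw_norm : ‖w‖ ≤ s⁻¹ * ‖p - y‖ + L * ‖p - z‖ := by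
    calc ‖w‖ = ‖s⁻¹ • (p - y) - (∇ g p - ∇ g z)‖ := by rw [hw]; congr 1; abel
      _ ≤ ‖s⁻¹ • (p - y)‖ + ‖∇ g p - ∇ g z‖ := norm_sub_le _ _
      _ ≤ s⁻¹ * ‖p - y‖ + L * ‖p - z‖ := by
        rw [norm_smul, Real.norm_of_nonneg (inv_nonneg.2 hs.le)]
        gcongr
        exact hL.norm_sub_le _ _
  have hyoung : ⟪w, u - p⟫ - μ / 2 * ‖u - p‖ ^ 2 ≤ ‖w‖ ^ 2 / (2 * μ) := by
    rw [le_div_iff₀ (by positivity)]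
    nlinarith [sq_nonneg (‖w‖ - μ * ‖u - p‖), real_inner_le_norm w (u - p)]
  have hsq : ‖w‖ ^ 2 / (2 * μ) ≤ (s⁻¹ * ‖p - y‖ + L * ‖p - z‖) ^ 2 / (2 * μ) := by gcongr
  linarith

end ProximalGradientStep

section LinearRate

theorem add_sq_le_mul_add_sq_of_decrease {A c K r r' δ δ' : ℝ} (hc : 0 ≤ c) (hcA : c < A)
    (hK : 0 ≤ K) (hdec : r' ≤ r - A * δ' ^ 2 + c * (δ * δ')) (herr : r' ≤ K * (δ + δ') ^ 2) :
    r' + A / 2 * δ' ^ 2 ≤ (4 * K + A) / (4 * K + 2 * A - c) * (r + A / 2 * δ ^ 2) := by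
  have hdrop : (A - c) / 2 * (δ ^ 2 + δ' ^ 2) ≤
      (r + A / 2 * δ ^ 2) - (r' + A / 2 * δ' ^ 2) := by
    linarith [mul_nonneg hc (sq_nonneg (δ - δ'))]
  have hbound : r' + A / 2 * δ' ^ 2 ≤ (4 * K + A) / 2 * (δ ^ 2 + δ' ^ 2) := by
    linarith [mul_nonneg hK (sq_nonneg (δ - δ')),
      mul_nonneg (hc.trans hcA.le) (sq_nonneg δ)]
  rw [div_mul_eq_mul_div (4 * K + A), le_div_iff₀ (by linarith)]
  linarith [mul_le_mul_of_nonneg_left hdrop (by linarith : 0 ≤ 4 * K + A),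
    mul_le_mul_of_nonneg_left hbound (sub_nonneg.2 hcA.le)]

theorem exists_eventually_le_mul_pow {V : ℕ → ℝ} {Q : ℝ} (hQ : 0 < Q)
    (hV : ∀ᶠ n in atTop, V (n + 1) ≤ Q * V n) : ∃ C > 0, ∀ᶠ n in atTop, V n ≤ C * Q ^ n := by
  obtain ⟨N, hN⟩ := eventually_atTop.1 hV
  refine ⟨max (V N / Q ^ N) 1, by positivity, eventually_atTop.2 ⟨N, fun n hn => ?_⟩⟩
  obtain ⟨k, rfl⟩ := Nat.exists_eq_add_of_le hn
  calc V (N + k) ≤ Q ^ k * V N :=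
        le_geom (u := fun k => V (N + k)) hQ.le k fun j _ => hN (N + j) (Nat.le_add_right N j)
    _ = V N / Q ^ N * Q ^ (N + k) := by rw [pow_add]; field_simp
    _ ≤ max (V N / Q ^ N) 1 * Q ^ (N + k) := by gcongr; exact le_max_left _ _

theorem exists_linear_rate_of_decrease {r δ : ℕ → ℝ} {A c K : ℝ} (hc : 0 ≤ c) (hcA : c < A)
    (hK : 0 ≤ K) (hr : ∀ᶠ n in atTop, 0 ≤ r n)
    (hdec : ∀ᶠ n in atTop, r (n + 1) ≤ r n - A * δ (n + 1) ^ 2 + c * (δ n * δ (n + 1)))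
    (herr : ∀ᶠ n in atTop, r (n + 1) ≤ K * (δ n + δ (n + 1)) ^ 2) :
    ∃ Q ∈ Ioo (0 : ℝ) 1, ∃ C > 0, ∀ᶠ n in atTop, r n ≤ C * Q ^ n ∧ δ n ^ 2 ≤ C * Q ^ n := by
  have hA : 0 < A := hc.trans_lt hcA
  set Q := (4 * K + A) / (4 * K + 2 * A - c) with hQ_def
  have hQ : Q ∈ Ioo (0 : ℝ) 1 := by
    rw [hQ_def, mem_Ioo, div_lt_one (by linarith)]
    exact ⟨div_pos (by linarith) (by linarith), by linarith⟩
  obtain ⟨C, hC, hV⟩ := exists_eventually_le_mul_pow (V := fun n => r n + A / 2 * δ n ^ 2) hQ.1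
    (hdec.and herr |>.mono fun n hn => add_sq_le_mul_add_sq_of_decrease hc hcA hK hn.1 hn.2)
  refine ⟨Q, hQ, C + 2 / A * C, by positivity, ?_⟩
  filter_upwards [hV, hr] with n hVn hrn
  have hCQ : 0 ≤ C * Q ^ n := mul_nonneg hC.le (pow_nonneg hQ.1.le n)
  have hCQ' : 0 ≤ 2 / A * (C * Q ^ n) := by positivity
  have hδ : δ n ^ 2 ≤ 2 / A * (C * Q ^ n) := by
    rw [div_mul_eq_mul_div, le_div_iff₀ hA]
    linarith
  have hδ_nonneg : 0 ≤ A / 2 * δ n ^ 2 := by positivity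
  rw [add_mul, mul_assoc (2 / A)]
  exact ⟨by linarith, by linarith⟩

theorem le_sqrt_mul_sqrt_of_mul_sq_le {μ t C q : ℝ} (hμ : 0 < μ) (hC : 0 ≤ C)
    (h : μ / 2 * t ^ 2 ≤ C * q) : t ≤ √(2 / μ * C) * √q := by
  rw [← Real.sqrt_mul (by positivity)]
  refine Real.le_sqrt_of_sq_le ?_
  calc t ^ 2 = 2 / μ * (μ / 2 * t ^ 2) := by field_simp
    _ ≤ 2 / μ * (C * q) := by gcongr ?_ * ?_
    _ = 2 / μ * C * q := by ring

end LinearRate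

section InertialScheme

variable {E : Type*} [NormedAddCommGroup E] [InnerProductSpace ℝ E] [CompleteSpace E]

/-- `x, y, z` are iterates of an inertial proximal gradient scheme with step size `s` for
`φ + g`, where the nonsmooth function is `φ` on `D` and `+∞` elsewhere. Both PADISNO and c-PADISNO
are of this form. As `0 - 1 = 0` in `ℕ`, the first step is taken without inertia. -/
structure IsInertialProxGrad (D : Set E) (φ g : E → ℝ) (s : ℝ) (α β : ℕ → ℝ)
    (x y z : ℕ → E) : Prop where
  y_eq : ∀ n, y n = x n + α n • (x n - x (n - 1))
  z_eq : ∀ n, z n = x n + β n • (x n - x (n - 1))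
  mem : ∀ n, x (n + 1) ∈ D
  isMinOn : ∀ n, IsMinOn (fun q => φ q + proxTerm s (∇ g (z n)) (y n) q) D (x (n + 1))

namespace IsInertialProxGrad

variable {D : Set E} {φ g : E → ℝ} {L : ℝ≥0} {s κ μ a b : ℝ} {α β : ℕ → ℝ} {x y z : ℕ → E}

theorem eventually_mem (h : IsInertialProxGrad D φ g s α β x y z) : ∀ᶠ n in atTop, x n ∈ D :=
  (eventually_ge_atTop 1).mono fun n hn => Nat.sub_add_cancel hn ▸ h.mem (n - 1)

theorem exists_descent (h : IsInertialProxGrad D φ g s α β x y z) {t : ℝ}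
    (ht : t < 1 - 2 * a ∨ ConvexOn ℝ D φ ∧ t < 2 * (1 - a)) :
    ∃ κ : ℝ, t < κ - 2 * a ∧ ∀ᶠ n in atTop,
      φ (x (n + 1)) + ⟪∇ g (z n) + s⁻¹ • (x n - y n), x (n + 1) - x n⟫ +
        κ / (2 * s) * ‖x (n + 1) - x n‖ ^ 2 ≤ φ (x n) := by
  -- `κ = 1` comes from comparing with `x n` alone, `κ = 2` from strong convexity of the subproblem
  rcases ht with ht | ⟨hφ, ht⟩
  · exact ⟨1, ht, h.eventually_mem.mono fun n hn => descent_of_proxTerm_le (h.isMinOn n hn)⟩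
  · exact ⟨2, by linarith, h.eventually_mem.mono fun n hn =>
      descent_of_convexOn_of_isMinOn hφ (h.mem n) (h.isMinOn n) hn⟩

theorem sum_succ_le (h : IsInertialProxGrad D φ g s α β x y z) (hg : Differentiable ℝ g)
    (hL : LipschitzWith L (∇ g)) (hs : 0 < s) {n : ℕ} (hα : |α n| ≤ a) (hβ : |β n| ≤ b)
    (hdescent : φ (x (n + 1)) + ⟪∇ g (z n) + s⁻¹ • (x n - y n), x (n + 1) - x n⟫ +
      κ / (2 * s) * ‖x (n + 1) - x n‖ ^ 2 ≤ φ (x n)) :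
    φ (x (n + 1)) + g (x (n + 1)) ≤ φ (x n) + g (x n) -
      (κ / (2 * s) - L / 2) * ‖x (n + 1) - x n‖ ^ 2 +
      (s⁻¹ * a + L * b) * (‖x n - x (n - 1)‖ * ‖x (n + 1) - x n‖) := by
  have herror : s⁻¹ * ‖x n - y n‖ + L * ‖x n - z n‖ ≤
      (s⁻¹ * a + L * b) * ‖x n - x (n - 1)‖ := by
    rw [h.y_eq, h.z_eq, sub_add_cancel_left, sub_add_cancel_left, norm_neg, norm_neg, norm_smul,
      norm_smul, Real.norm_eq_abs, Real.norm_eq_abs, add_mul, mul_assoc, mul_assoc]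
    gcongr
  refine (sum_le_sub_of_descent hg hL hs hdescent).trans ?_
  rw [← mul_assoc (s⁻¹ * a + L * b)]
  gcongr

theorem gap_succ_le (h : IsInertialProxGrad D φ g s α β x y z) (hg : Differentiable ℝ g)
    (hL : LipschitzWith L (∇ g)) (hs : 0 < s) (hμ : 0 < μ)
    (hsc : StrongConvexOn D μ fun q => φ q + g q) {u : E} (hu : u ∈ D) {n : ℕ}
    (hα : |α n| ≤ a) (hβ : |β n| ≤ b) :
    φ (x (n + 1)) + g (x (n + 1)) - (φ u + g u) ≤ ((s⁻¹ + L) * (1 + a + b)) ^ 2 / (2 * μ) *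
      (‖x n - x (n - 1)‖ + ‖x (n + 1) - x n‖) ^ 2 := by
  set ρ := ‖x n - x (n - 1)‖ + ‖x (n + 1) - x n‖
  have ha : 0 ≤ a := (abs_nonneg _).trans hα
  have hb : 0 ≤ b := (abs_nonneg _).trans hβ
  have hdist : ∀ γ : ℝ, |γ| ≤ a + b →
      ‖x (n + 1) - (x n + γ • (x n - x (n - 1)))‖ ≤ (1 + a + b) * ρ := by
    intro γ hγ
    calc ‖x (n + 1) - (x n + γ • (x n - x (n - 1)))‖
        ≤ ‖x (n + 1) - x n‖ + |γ| * ‖x n - x (n - 1)‖ := by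
          rw [← sub_sub, ← Real.norm_eq_abs, ← norm_smul]
          exact norm_sub_le _ _
      _ ≤ ρ + (a + b) * ρ := by
          gcongr
          · exact le_add_of_nonneg_left (norm_nonneg _)
          · exact le_add_of_nonneg_right (norm_nonneg _)
      _ = (1 + a + b) * ρ := by ring
  calc φ (x (n + 1)) + g (x (n + 1)) - (φ u + g u)
      ≤ (s⁻¹ * ‖x (n + 1) - y n‖ + L * ‖x (n + 1) - z n‖) ^ 2 / (2 * μ) :=
        gap_le_sq_of_isMinOn hg hL hs hμ hsc (h.mem n) (h.isMinOn n) hu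
    _ ≤ (s⁻¹ * ((1 + a + b) * ρ) + L * ((1 + a + b) * ρ)) ^ 2 / (2 * μ) := by
        rw [h.y_eq, h.z_eq]
        gcongr
        · exact hdist _ (by linarith)
        · exact hdist _ (by linarith)
    _ = ((s⁻¹ + L) * (1 + a + b)) ^ 2 / (2 * μ) * ρ ^ 2 := by ring

theorem exists_linear_rate (h : IsInertialProxGrad D φ g s α β x y z) (hg : Differentiable ℝ g)
    (hL : LipschitzWith L (∇ g)) (hs : 0 < s) (hμ : 0 < μ)
    (hsc : StrongConvexOn D μ fun q => φ q + g q) {u : E} (hu : u ∈ D)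
    (hmin : IsMinOn (fun q => φ q + g q) D u)
    (hα : ∀ᶠ n in atTop, |α n| ≤ a) (hβ : ∀ᶠ n in atTop, |β n| ≤ b)
    (hstep : s * (L * (2 * b + 1)) < 1 - 2 * a ∨
      ConvexOn ℝ D φ ∧ s * (L * (2 * b + 1)) < 2 * (1 - a)) :
    ∃ Q ∈ Ioo (0 : ℝ) 1, ∃ C > 0, ∀ᶠ n in atTop,
      φ (x n) + g (x n) - (φ u + g u) ≤ C * Q ^ n ∧ ‖x n - x (n - 1)‖ ^ 2 ≤ C * Q ^ n := by
  obtain ⟨κ, hκ, hdescent⟩ := h.exists_descent hstep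
  have ha : 0 ≤ a := (abs_nonneg _).trans hα.exists.choose_spec
  have hb : 0 ≤ b := (abs_nonneg _).trans hβ.exists.choose_spec
  have hcA : s⁻¹ * a + L * b < κ / (2 * s) - L / 2 := by
    have hdiff : κ / (2 * s) - L / 2 - (s⁻¹ * a + L * b) =
        (κ - 2 * a - s * (L * (2 * b + 1))) / (2 * s) := by
      field_simp
      ring
    rw [← sub_pos, hdiff]
    exact div_pos (by linarith) (by linarith)
  refine exists_linear_rate_of_decrease (r := fun n => φ (x n) + g (x n) - (φ u + g u))
    (δ := fun n => ‖x n - x (n - 1)‖) (K := ((s⁻¹ + L) * (1 + a + b)) ^ 2 / (2 * μ))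
    (by positivity) hcA (by positivity)
    (h.eventually_mem.mono fun n hn => sub_nonneg.2 (hmin hn)) ?_ ?_
  · filter_upwards [hα, hβ, hdescent] with n hαn hβn hn
    have hdec := h.sum_succ_le hg hL hs hαn hβn hn
    rw [Nat.add_sub_cancel]
    linarith
  · filter_upwards [hα, hβ] with n hαn hβn
    exact h.gap_succ_le hg hL hs hμ hsc hu hαn hβn

theorem exists_linear_convergence (h : IsInertialProxGrad D φ g s α β x y z)
    (hg : Differentiable ℝ g) (hL : LipschitzWith L (∇ g)) (hs : 0 < s) (hμ : 0 < μ)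
    (hsc : StrongConvexOn D μ fun q => φ q + g q) {u : E} (hu : u ∈ D)
    (hmin : IsMinOn (fun q => φ q + g q) D u)
    (hα : ∀ᶠ n in atTop, |α n| ≤ a) (hβ : ∀ᶠ n in atTop, |β n| ≤ b)
    (hstep : s * (L * (2 * b + 1)) < 1 - 2 * a ∨
      ConvexOn ℝ D φ ∧ s * (L * (2 * b + 1)) < 2 * (1 - a)) :
    ∃ Q ∈ Ioo (0 : ℝ) 1, ∃ C > 0, ∀ᶠ n in atTop,
      φ (x n) + g (x n) - (φ u + g u) ≤ C * Q ^ n ∧ ‖x n - u‖ ≤ C * √(Q ^ n) ∧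
        ‖y n - u‖ ≤ C * √(Q ^ n) ∧ ‖z n - u‖ ≤ C * √(Q ^ n) := by
  obtain ⟨Q, hQ, C, hC, hrate⟩ :=
    h.exists_linear_rate hg hL hs hμ hsc hu hmin hα hβ hstep
  have ha : 0 ≤ a := (abs_nonneg _).trans hα.exists.choose_spec
  have hb : 0 ≤ b := (abs_nonneg _).trans hβ.exists.choose_spec
  refine ⟨Q, hQ, C + √(2 / μ * C) + (a + b) * √C, by positivity, ?_⟩
  filter_upwards [hrate, hα, hβ, h.eventually_mem] with n ⟨hgap, hδ⟩ hαn hβn hxn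
  have hQn : 0 ≤ Q ^ n := pow_nonneg hQ.1.le n
  have hx : ‖x n - u‖ ≤ √(2 / μ * C) * √(Q ^ n) := le_sqrt_mul_sqrt_of_mul_sq_le hμ hC.le
    ((sq_norm_sub_le_of_isMinOn hsc hu hmin hxn).trans hgap)
  have hd : ‖x n - x (n - 1)‖ ≤ √C * √(Q ^ n) := by
    rw [← Real.sqrt_mul hC.le]
    exact Real.le_sqrt_of_sq_le hδ
  have hextrapolated : ∀ γ : ℝ, |γ| ≤ a + b → ‖x n + γ • (x n - x (n - 1)) - u‖ ≤
      (C + √(2 / μ * C) + (a + b) * √C) * √(Q ^ n) := by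
    intro γ hγ
    calc ‖x n + γ • (x n - x (n - 1)) - u‖ ≤ ‖x n - u‖ + |γ| * ‖x n - x (n - 1)‖ := by
          rw [add_sub_right_comm, ← Real.norm_eq_abs, ← norm_smul]
          exact norm_add_le _ _
      _ ≤ √(2 / μ * C) * √(Q ^ n) + (a + b) * (√C * √(Q ^ n)) := by gcongr
      _ ≤ C * √(Q ^ n) + (√(2 / μ * C) * √(Q ^ n) + (a + b) * (√C * √(Q ^ n))) :=
          le_add_of_nonneg_left (by positivity)
      _ = (C + √(2 / μ * C) + (a + b) * √C) * √(Q ^ n) := by ring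
  refine ⟨hgap.trans ?_, ?_, ?_, ?_⟩
  · gcongr
    rw [add_assoc]
    exact le_add_of_nonneg_right (by positivity)
  · simpa using hextrapolated 0 (by simpa using add_nonneg ha hb)
  · rw [h.y_eq]
    exact hextrapolated _ (by linarith)
  · rw [h.z_eq]
    exact hextrapolated _ (by linarith)

end IsInertialProxGrad

end InertialScheme

section ExtendedReal

variable {E : Type*} {f : E → EReal}

theorem add_coe_lt_top_iff {a : EReal} {r : ℝ} : a + r < ⊤ ↔ a < ⊤ := by
  rw [lt_top_iff_ne_top, lt_top_iff_ne_top,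
    EReal.add_ne_top_iff_of_ne_bot_of_ne_top (EReal.coe_ne_bot r) (EReal.coe_ne_top r)]

theorem coe_toReal_add_eq (hbot : ∀ q, f q ≠ ⊥) (h : E → ℝ) {q : E} (hq : f q < ⊤) :
    (((f q).toReal + h q : ℝ) : EReal) = f q + h q := by
  rw [EReal.coe_add, EReal.coe_toReal hq.ne (hbot q)]

theorem forall_add_coe_le_iff (hbot : ∀ q, f q ≠ ⊥) (hne : {q | f q < ⊤}.Nonempty) {h : E → ℝ}
    {p : E} : (∀ q, f p + h p ≤ f q + h q) ↔
      f p < ⊤ ∧ IsMinOn (fun q => (f q).toReal + h q) {q | f q < ⊤} p := by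
  constructor
  · intro hmin
    obtain ⟨q₀, hq₀⟩ := hne
    have hp : f p < ⊤ := add_coe_lt_top_iff.1 ((hmin q₀).trans_lt (add_coe_lt_top_iff.2 hq₀))
    refine ⟨hp, isMinOn_iff.2 fun q hq => ?_⟩
    rw [← EReal.coe_le_coe_iff, coe_toReal_add_eq hbot h hp, coe_toReal_add_eq hbot h hq]
    exact hmin q
  · rintro ⟨hp, hmin⟩ q
    rcases (le_top : f q ≤ ⊤).lt_or_eq with hq | hq
    · rw [← coe_toReal_add_eq hbot h hp, ← coe_toReal_add_eq hbot h hq, EReal.coe_le_coe_iff]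
      exact isMinOn_iff.1 hmin q hq
    · rw [hq, EReal.top_add_coe]
      exact le_top

theorem isClosed_setOf_toReal_add_le [TopologicalSpace E] (hbot : ∀ q, f q ≠ ⊥)
    (hf : LowerSemicontinuous f) {h : E → ℝ} (hh : Continuous h) (r : ℝ) :
    IsClosed {q ∈ {q | f q < ⊤} | (f q).toReal + h q ≤ r} := by
  have hsum : LowerSemicontinuous fun q => f q + h q :=
    hf.add' (continuous_coe_real_ereal.comp hh).lowerSemicontinuous fun _ =>
      EReal.continuousAt_add (Or.inr (EReal.coe_ne_bot _)) (Or.inr (EReal.coe_ne_top _))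
  have hset : {q ∈ {q | f q < ⊤} | (f q).toReal + h q ≤ r} =
      (fun q => f q + h q) ⁻¹' Iic (r : EReal) := by
    ext q
    refine ⟨fun ⟨hq, hle⟩ => ?_, fun hle => ?_⟩
    · rw [mem_preimage, mem_Iic, ← coe_toReal_add_eq hbot h hq]
      exact EReal.coe_le_coe_iff.2 hle
    · have hq : f q < ⊤ :=
        add_coe_lt_top_iff.1 (lt_of_le_of_lt (mem_Iic.1 hle) (EReal.coe_lt_top r))
      rw [mem_preimage, mem_Iic, ← coe_toReal_add_eq hbot h hq] at hle
      exact ⟨hq, EReal.coe_le_coe_iff.1 hle⟩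
  exact hset ▸ hsum.isClosed_preimage r

theorem strongConvexOn_toReal_add [NormedAddCommGroup E] [NormedSpace ℝ E] (hbot : ∀ q, f q ≠ ⊥)
    {h : E → ℝ} {μ : ℝ} (hsc : StrongConvexOn {q | f q + h q < ⊤} μ fun q => (f q + h q).toReal) :
    StrongConvexOn {q | f q < ⊤} μ fun q => (f q).toReal + h q := by
  have hval : ∀ q ∈ {q | f q < ⊤}, (f q + h q).toReal = (f q).toReal + h q := fun q hq => by
    rw [← coe_toReal_add_eq hbot h hq, EReal.toReal_coe]
  simp only [add_coe_lt_top_iff] at hsc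
  refine ⟨hsc.1, fun u hu v hv t t' ht ht' htt' => ?_⟩
  have hconv := hsc.2 hu hv ht ht' htt'
  simpa only [hval _ hu, hval _ hv, hval _ (hsc.1 hu hv ht ht' htt')] using hconv

theorem exists_setOf_forall_add_le_eq_singleton [NormedAddCommGroup E] [NormedSpace ℝ E]
    [CompleteSpace E] (hbot : ∀ q, f q ≠ ⊥) (hne : {q | f q < ⊤}.Nonempty)
    (hf : LowerSemicontinuous f) {h : E → ℝ} (hh : Continuous h) {μ : ℝ} (hμ : 0 < μ)
    (hsc : StrongConvexOn {q | f q < ⊤} μ fun q => (f q).toReal + h q) :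
    ∃ u, {p | ∀ q, f p + h p ≤ f q + h q} = {u} := by
  obtain ⟨u, hu, hmin⟩ := exists_isMinOn_of_strongConvexOn hμ hsc hne
    (isClosed_setOf_toReal_add_le hbot hf hh)
  refine ⟨u, eq_singleton_iff_unique_mem.2
    ⟨(forall_add_coe_le_iff hbot hne).2 ⟨hu, hmin⟩, fun p hp => ?_⟩⟩
  obtain ⟨hpD, hpmin⟩ := (forall_add_coe_le_iff hbot hne).1 hp
  exact (hsc.strictConvexOn hμ).eq_of_isMinOn hpmin hmin hpD hu

theorem add_proxTerm_le_of_add_sq_le [NormedAddCommGroup E] [InnerProductSpace ℝ E] {s : ℝ}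
    (hs : s ≠ 0) {c y p q : E}
    (h : f p + ((1 / (2 * s) * ‖p - (y - s • c)‖ ^ 2 : ℝ) : EReal) ≤
      f q + ((1 / (2 * s) * ‖q - (y - s • c)‖ ^ 2 : ℝ) : EReal)) :
    f p + (proxTerm s c y p : EReal) ≤ f q + (proxTerm s c y q : EReal) := by
  rw [← proxTerm_add_const_eq hs, ← proxTerm_add_const_eq hs, EReal.coe_add, EReal.coe_add,
    ← add_assoc, ← add_assoc] at h
  exact (EReal.addLECancellable_coe _).add_le_add_iff_right.1 h

end ExtendedReal

theorem exists_eventually_abs_le_of_tendsto {α β : ℕ → ℝ} {a b s κ : ℝ} (L : ℝ)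
    (hα : Tendsto α atTop (𝓝 a)) (hβ : Tendsto β atTop (𝓝 b))
    (h : s * (L * (2 * |b| + 1)) < κ - 2 * |a|) :
    ∃ a' b' : ℝ, (∀ᶠ n in atTop, |α n| ≤ a') ∧ (∀ᶠ n in atTop, |β n| ≤ b') ∧
      s * (L * (2 * b' + 1)) < κ - 2 * a' := by
  have hlim : Tendsto (fun ε : ℝ => s * (L * (2 * (|b| + ε) + 1)) + 2 * (|a| + ε)) (𝓝[>] 0)
      (𝓝 (s * (L * (2 * (|b| + 0) + 1)) + 2 * (|a| + 0))) :=
    (Continuous.tendsto (by fun_prop) 0).mono_left nhdsWithin_le_nhds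
  obtain ⟨ε, hlt, hε⟩ := ((hlim.eventually_lt_const (u := κ) (by linarith)).and
    (eventually_mem_nhdsWithin : ∀ᶠ ε : ℝ in 𝓝[>] 0, ε ∈ Ioi 0)).exists
  exact ⟨|a| + ε, |b| + ε, hα.abs.eventually_le_const (lt_add_of_pos_right _ hε),
    hβ.abs.eventually_le_const (lt_add_of_pos_right _ hε), by linarith⟩

theorem theorem5p1_general {E : Type*} [NormedAddCommGroup E] [InnerProductSpace ℝ E]
    [CompleteSpace E] {f : E → EReal} {g : E → ℝ} {L : ℝ≥0} (hbot : ∀ q, f q ≠ ⊥)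
    (hne : {q | f q < ⊤}.Nonempty) (hf : LowerSemicontinuous f) (hg : Differentiable ℝ g)
    (hL : LipschitzWith L (∇ g)) {α β : ℕ → ℝ} {a b s : ℝ} {x y z : ℕ → E}
    (hα : ∀ᶠ n in atTop, |α n| ≤ a) (hβ : ∀ᶠ n in atTop, |β n| ≤ b) (hs : 0 < s)
    (hy : ∀ n, y n = x n + α n • (x n - x (n - 1)))
    (hz : ∀ n, z n = x n + β n • (x n - x (n - 1)))
    (hstep : ∀ n q, f (x (n + 1)) + (proxTerm s (∇ g (z n)) (y n) (x (n + 1)) : EReal) ≤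
      f q + (proxTerm s (∇ g (z n)) (y n) q : EReal))
    (hs_lt : s * (L * (2 * b + 1)) < 1 - 2 * a ∨
      ConvexOn ℝ {q | f q < ⊤} (fun q => (f q).toReal) ∧ s * (L * (2 * b + 1)) < 2 * (1 - a))
    (hsc : ∃ μ : ℝ, 0 < μ ∧
      StrongConvexOn {q | f q + g q < ⊤} μ fun q => (f q + g q).toReal) :
    ∃ xstar : E, {p | ∀ q, f p + g p ≤ f q + g q} = {xstar} ∧
      ∃ Q ∈ Ico (0 : ℝ) 1, ∃ a₁ : ℝ, 0 < a₁ ∧ ∃ N : ℕ, ∀ n ≥ N,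
        (f (x n) + g (x n)) - (f xstar + g xstar) ≤ ((a₁ * Q ^ n : ℝ) : EReal) ∧
        ‖x n - xstar‖ ≤ a₁ * Q ^ ((n : ℝ) / 2) ∧
        ‖y n - xstar‖ ≤ a₁ * Q ^ ((n : ℝ) / 2) ∧
        ‖z n - xstar‖ ≤ a₁ * Q ^ ((n : ℝ) / 2) := by
  obtain ⟨μ, hμ, hsc⟩ := hsc
  replace hsc := strongConvexOn_toReal_add hbot hsc
  have hscheme : IsInertialProxGrad {q | f q < ⊤} (fun q => (f q).toReal) g s α β x y z :=
    ⟨hy, hz, fun n => ((forall_add_coe_le_iff hbot hne).1 (hstep n)).1,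
      fun n => ((forall_add_coe_le_iff hbot hne).1 (hstep n)).2⟩
  obtain ⟨u, hargmin⟩ := exists_setOf_forall_add_le_eq_singleton hbot hne hf hg.continuous hμ hsc
  obtain ⟨hu, hmin⟩ := (forall_add_coe_le_iff hbot hne).1 (hargmin.ge (mem_singleton u))
  obtain ⟨Q, hQ, C, hC, hrate⟩ :=
    hscheme.exists_linear_convergence hg hL hs hμ hsc hu hmin hα hβ hs_lt
  obtain ⟨N, hN⟩ := eventually_atTop.1 (hrate.and hscheme.eventually_mem)
  refine ⟨u, hargmin, Q, ⟨hQ.1.le, hQ.2⟩, C, hC, N, fun n hn => ?_⟩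
  obtain ⟨⟨hgap, hxyz⟩, hxn⟩ := hN n hn
  have hsqrt : Q ^ ((n : ℝ) / 2) = √(Q ^ n) := by
    rw [Real.sqrt_eq_rpow, ← Real.rpow_natCast, ← Real.rpow_mul hQ.1.le, mul_one_div]
  rw [hsqrt, ← coe_toReal_add_eq hbot g hxn, ← coe_toReal_add_eq hbot g hu, ← EReal.coe_sub,
    EReal.coe_le_coe_iff]
  exact ⟨hgap, hxyz⟩

theorem theorem5p1 {m : ℕ} (f : EuclideanSpace ℝ (Fin m) → EReal)
    (g : EuclideanSpace ℝ (Fin m) → ℝ) (L : ℝ≥0) (hfg : ProblemSetting f g L)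
    (α β : ℕ → ℝ) (a b s : ℝ) (x y z : ℕ → EuclideanSpace ℝ (Fin m))
    (hgen : IsPADISNO f g L α β a b s x y z ∨ IsCPADISNO f g L α β a b s x y z)
    (hsc : IsStronglyConvexFun (objective f g)) :
    ∃ xstar : EuclideanSpace ℝ (Fin m), argminSet (objective f g) = {xstar} ∧
      ∃ Q ∈ Set.Ico (0 : ℝ) 1, ∃ a₁ : ℝ, 0 < a₁ ∧ ∃ N : ℕ, ∀ n ≥ N,
        objective f g (x n) - objective f g xstar ≤ ((a₁ * Q ^ n : ℝ) : EReal) ∧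
        ‖x n - xstar‖ ≤ a₁ * Q ^ ((n : ℝ) / 2) ∧
        ‖y n - xstar‖ ≤ a₁ * Q ^ ((n : ℝ) / 2) ∧
        ‖z n - xstar‖ ≤ a₁ * Q ^ ((n : ℝ) / 2) := by
  rcases hgen with h | h
  · obtain ⟨a', b', hα, hβ, hs_lt⟩ :=
      exists_eventually_abs_le_of_tendsto L h.α_lim h.β_lim h.s_lt
    exact theorem5p1_general hfg.proper.1 hfg.proper.2 hfg.lsc hfg.diff hfg.lipschitz hα hβ
      h.s_pos h.extrapolation.y_eq h.extrapolation.z_eq h.step (Or.inl hs_lt) hsc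
  · obtain ⟨a', b', hα, hβ, hs_lt⟩ :=
      exists_eventually_abs_le_of_tendsto (s := s) (κ := 2) L h.α_lim h.β_lim
        (by linarith [h.s_lt])
    exact theorem5p1_general hfg.proper.1 hfg.proper.2 hfg.lsc hfg.diff hfg.lipschitz hα hβ
      h.s_pos h.extrapolation.y_eq h.extrapolation.z_eq
      (fun n q => add_proxTerm_le_of_add_sq_le h.s_pos.ne' (h.step n q))
      (Or.inr ⟨h.convex, by linarith⟩) hsc
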